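/- A computable metric space is a triple $(X,d,\alpha)$, where $(X,d)$ is a metric space and $\alpha=(\alpha_i)_{i\in\mathbb N}$ is a sequence dense in $X$ such that $(i,j)\mapsto d(\alpha_i,\alpha_j)$ is a computable function $\mathbb N^2\to\mathbb R$. A point $a\in X$ is computable if there is a computable $f:\mathbb N\to\mathbb N$ with $d(a,\alpha_{f(k)})<2^{-k}$ for all $k$. Let $(I_i)_{i\in\mathbb N}$ and $(\widehat I_i)_{i\in\mathbb N}$ be effective enumerations of all open, respectively closed, rational balls, where $I_i$ and $\widehat I_i$ have the same center (some $\alpha_n$) and the same positive rational radius, and let $(J_j)_{j\in\mathbb N}$ be an effective enumeration of all finite nonempty unions of the balls $I_i$. A closed set $S\subseteq X$ is computably enumerable if $\{i\mid S\cap I_i\neq\emptyset\}$ is a c.e. subset of $\mathbb N$. A set $S\subseteq X$ is semi-c.c.b. if $S\cap B$ is compact for every closed ball $B$ of positive radius in $(X,d)$ and $\{(i,j)\in\mathbb N^2\mid \widehat I_i\cap S\subseteq J_j\}$ is c.e.; it is c.c.b. if it is semi-c.c.b. and computably enumerable. A topological ray is a space $R$ that admits a homeomorphism $f:[0,\infty)\to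 R$; the point $f(0)$ is its endpoint. Theorem. Let $(X,d,\alpha)$ be a computable metric space. Let $R$ be a closed subset of $X$ which, as a subspace of $(X,d)$, is a topological ray whose endpoint is computable. Suppose that $F$ is a closed set in $(X,d)$ which is disjoint from $R$ and such that $R\cup F$ is semi-c.c.b. Then $R$ is computably enumerable. In particular, every semi-c.c.b. set $R\subseteq X$ which is a topological ray with computable endpoint is c.c.b. -/

import Mathlib

namespace ComputableMetric

/-- A function `F : β → ℚ` (with `β = ℕ`, `ℕ × ℕ`, ...) is computable if
`F x = (-1) ^ c x * a x / (b x + 1)` for some recursive `a, b, c : β → ℕ`. -/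
def IsComputableRatFun {β : Type*} [Primcodable β] (F : β → ℚ) : Prop :=
  ∃ a b c : β → ℕ, Computable a ∧ Computable b ∧ Computable c ∧
    ∀ x, F x = (-1) ^ c x * ((a x : ℚ) / ((b x : ℚ) + 1))

/-- A function `f : β → ℝ` is computable if some computable `F : β × ℕ → ℚ` satisfies
`|f x - F (x, i)| < 2 ^ (-i)` for all `x` and `i`. -/
def IsComputableRealFun {β : Type*} [Primcodable β] (f : β → ℝ) : Prop :=
  ∃ F : β × ℕ → ℚ, IsComputableRatFun F ∧ ∀ x i, |f x - (F (x, i) : ℝ)| < (1 / 2 : ℝ) ^ i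

/-- `(X, d, α)` is a computable metric space. -/
structure IsComputableMetricSpace {X : Type*} [MetricSpace X] (α : ℕ → X) : Prop where
  dense : DenseRange α
  computable_dist : IsComputableRealFun fun p : ℕ × ℕ => dist (α p.1) (α p.2)

/-- `a` is a computable point of `(X, d, α)`. -/
def IsComputablePoint {X : Type*} [MetricSpace X] (α : ℕ → X) (a : X) : Prop :=
  ∃ f : ℕ → ℕ, Computable f ∧ ∀ k, dist a (α (f k)) < (1 / 2 : ℝ) ^ k

/-- A choice of the recursive functions used to enumerate the rational balls and their finite
unions: `q` enumerates the positive rationals, `(τ₁, τ₂)` enumerates the pairs of naturals, and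
`j ↦ (σ j 0, ..., σ j (η j))` enumerates the nonempty finite sequences of naturals. -/
structure EffectiveEnumeration where
  q : ℕ → ℚ
  τ₁ : ℕ → ℕ
  τ₂ : ℕ → ℕ
  σ : ℕ → ℕ → ℕ
  η : ℕ → ℕ
  computable_q : IsComputableRatFun q
  range_q : Set.range q = Set.Ioi 0
  computable_τ₁ : Computable τ₁
  computable_τ₂ : Computable τ₂
  surjective_τ : Function.Surjective fun i => (τ₁ i, τ₂ i)
  computable_σ : Computable₂ σ
  computable_η : Computable η
  exists_eq_list : ∀ l : List ℕ, l ≠ [] → ∃ j, (List.range (η j + 1)).map (σ j) = l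

/-- Such enumerations exist. -/
theorem EffectiveEnumeration.nonempty : Nonempty EffectiveEnumeration := by
  refine ⟨{
    q := fun n => ((n.unpair.1 + 1 : ℕ) : ℚ) / ((n.unpair.2 : ℚ) + 1)
    τ₁ := fun n => n.unpair.1
    τ₂ := fun n => n.unpair.2
    σ := fun j i => (Denumerable.ofNat (List ℕ) j).getD i 0
    η := fun j => (Denumerable.ofNat (List ℕ) j).length - 1
    computable_q := ?_
    range_q := ?_
    computable_τ₁ := (Primrec.fst.comp Primrec.unpair).to_comp
    computable_τ₂ := (Primrec.snd.comp Primrec.unpair).to_comp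
    surjective_τ := ?_
    computable_σ := ?_
    computable_η := ?_
    exists_eq_list := ?_ }⟩
  · refine ⟨fun n => n.unpair.1 + 1, fun n => n.unpair.2, fun _ => 0,
      (Primrec.succ.comp (Primrec.fst.comp Primrec.unpair)).to_comp,
      (Primrec.snd.comp Primrec.unpair).to_comp, Computable.const 0, fun x => by simp⟩
  · ext r
    constructor
    · rintro ⟨n, rfl⟩
      simp only [Set.mem_Ioi]
      positivity
    · intro hr
      have hr : 0 < r := hr
      have hn : 0 < r.num := Rat.num_pos.mpr hr
      refine ⟨Nat.pair (r.num.toNat - 1) (r.den - 1), ?_⟩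
      have h1 : r.num.toNat - 1 + 1 = r.num.toNat := by omega
      have h2 : ((r.den - 1 : ℕ) : ℚ) + 1 = r.den := by
        have := r.den_pos
        exact_mod_cast (show r.den - 1 + 1 = r.den by omega)
      have h3 : ((r.num.toNat : ℕ) : ℚ) = r.num := by
        exact_mod_cast Int.toNat_of_nonneg hn.le
      simp only [Nat.unpair_pair, h1, h2, h3]
      exact Rat.num_div_den r
  · rintro ⟨a, b⟩
    exact ⟨Nat.pair a b, by simp⟩
  · exact ((Primrec.list_getD 0).comp
      ((Primrec.ofNat (List ℕ)).comp Primrec.fst) Primrec.snd).to_comp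
  · exact (Primrec.pred.comp (Primrec.list_length.comp (Primrec.ofNat (List ℕ)))).to_comp
  · intro l hl
    refine ⟨Encodable.encode l, ?_⟩
    have hpos : 0 < l.length := List.length_pos_iff.mpr hl
    apply List.ext_getElem
    · simp
      omega
    · intro i h1 h2
      simp [h2]

namespace EffectiveEnumeration

variable (E : EffectiveEnumeration)

/-- The finite nonempty set `[j] = {σ j i | 0 ≤ i ≤ η j}`. -/
def index (j : ℕ) : Set ℕ := {k | ∃ i ≤ E.η j, E.σ j i = k}

/-- The open rational ball `I i = B(α (τ₁ i), q (τ₂ i))`. -/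
def ball {X : Type*} [MetricSpace X] (α : ℕ → X) (i : ℕ) : Set X :=
  Metric.ball (α (E.τ₁ i)) (E.q (E.τ₂ i) : ℝ)

/-- The closed rational ball with the same center and radius as `I i`. -/
def closedBall {X : Type*} [MetricSpace X] (α : ℕ → X) (i : ℕ) : Set X :=
  Metric.closedBall (α (E.τ₁ i)) (E.q (E.τ₂ i) : ℝ)

/-- The rational open set `J j`, the union of the `I i` with `i ∈ [j]`. -/
def openSet {X : Type*} [MetricSpace X] (α : ℕ → X) (j : ℕ) : Set X :=
  ⋃ i ∈ E.index j, E.ball α i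

end EffectiveEnumeration

/-- `S` is a computably enumerable (closed) set in `(X, d, α)`. -/
def IsCE {X : Type*} [MetricSpace X] (E : EffectiveEnumeration) (α : ℕ → X) (S : Set X) : Prop :=
  IsClosed S ∧ REPred fun i : ℕ => (S ∩ E.ball α i).Nonempty

/-- `S` is semi-computable compact on closed balls. -/
structure IsSemiCCB {X : Type*} [MetricSpace X] (E : EffectiveEnumeration) (α : ℕ → X)
    (S : Set X) : Prop where
  isCompact : ∀ (x : X) (r : ℝ), 0 < r → IsCompact (S ∩ Metric.closedBall x r)
  re_cover : REPred fun p : ℕ × ℕ => E.closedBall α p.1 ∩ S ⊆ E.openSet α p.2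

/-- `S` is computable compact on closed balls. -/
structure IsCCB {X : Type*} [MetricSpace X] (E : EffectiveEnumeration) (α : ℕ → X)
    (S : Set X) : Prop extends IsSemiCCB E α S where
  ce : IsCE E α S

/-- The space `R` is a topological ray with endpoint `e`: some homeomorphism from `[0, ∞)` onto
`R` maps `0` to `e`. -/
def IsRayWithEndpoint (R : Type*) [TopologicalSpace R] (e : R) : Prop :=
  ∃ f : Set.Ici (0 : ℝ) ≃ₜ R, f ⟨0, Set.self_mem_Ici⟩ = e

end ComputableMetric

/-!
The ray `R` is computably enumerable because the property `R ∩ I t ≠ ∅` has finite certificates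
that can be searched for. If a short arc of `R` inside `I t` is removed, `R ∪ F` falls apart into a
compact set, the initial part of the ray with its endpoint `e`, and a disjoint closed set, the
final part of the ray together with `F`. Hence, in a large closed rational ball `b`, the set `R ∪ F`
is covered by finitely many small rational balls of three kinds: those that form `J a`, a
neighbourhood of the initial part inside `b`; those that form `J d`, a neighbourhood of the rest
that is separated from `J a`; and those contained in `I t`. This is a certificate
(`IsHitCertificate`), and the argument shows that one exists whenever `R` meets `I t`
(`IsSemiCCB.exists_isHitCertificate`, `IsRayWithEndpoint.exists_isHitCertificate`).

Conversely, a certificate forces `R` to meet `I t` (`IsHitCertificate.nonempty_inter`). The ray is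
closed and not compact, and bounded closed subsets of a semi-c.c.b. set are compact, so `R` is
unbounded and leaves `b`. As `R` is connected and starts in `J a`, it cannot be covered by the
disjoint open sets `J a` and `J d ∪ bᶜ`, so some point of `R` lies in a ball of the third kind.

Being a certificate is semi-decidable (`re_isHitCertificate`): the cover condition by hypothesis,
`e ∈ J a` because `e` is a computable point, and inclusion and disjointness of balls once they are
replaced by strict inequalities between distances of centers and radii (`FormallySubset`,
`FormallyDisjoint`), which are inequalities between computable real functions
(`IsComputableRealFun.lt_re`).
-/

/-! ### Closure properties of recursively enumerable predicates -/

section RecursivelyEnumerable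

variable {β γ : Type*} [Primcodable β] [Primcodable γ]

theorem REPred.comp_computable {p : γ → Prop} (hp : REPred p) {f : β → γ} (hf : Computable f) :
    REPred fun b => p (f b) :=
  Partrec.comp hp hf

theorem REPred.and {p q : β → Prop} (hp : REPred p) (hq : REPred q) :
    REPred fun b => p b ∧ q b := by
  refine (Partrec.dom_re (Partrec.bind hp (hq.comp_computable Computable.fst).to₂)).of_eq ?_
  intro b
  simp [Part.assert]

theorem REPred.or {p q : β → Prop} (hp : REPred p) (hq : REPred q) :
    REPred fun b => p b ∨ q b := by
  obtain ⟨k, hk, h⟩ := Partrec.merge' hp hq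
  refine (Partrec.dom_re hk).of_eq fun b => ?_
  simp [(h b).2, Part.assert]

/-- A recursively enumerable predicate is the projection of a decidable one. -/
theorem REPred.exists_computable {p : β → Prop} (hp : REPred p) :
    ∃ q : β × ℕ → Bool, Computable q ∧ ∀ b, p b ↔ ∃ n, q (b, n) = true := by
  obtain ⟨c, hc⟩ := Nat.Partrec.Code.exists_code.1 hp
  refine ⟨fun x => (Nat.Partrec.Code.evaln x.2 c (Encodable.encode x.1)).isSome, ?_, fun b => ?_⟩
  · exact (Primrec.option_isSome.comp (Nat.Partrec.Code.primrec_evaln.comp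
      (((Primrec.snd.pair (Primrec.const c)).pair (Primrec.encode.comp Primrec.fst))))).to_comp
  · have h1 : p b ↔ ∃ x, x ∈ Nat.Partrec.Code.eval c (Encodable.encode b) := by
      simp [hc, Part.assert]
    rw [h1]
    simp only [Nat.Partrec.Code.evaln_complete, Option.isSome_iff_exists, Option.mem_def]
    exact exists_comm

/-- A predicate that searches for a witness of a decidable predicate is recursively
enumerable. -/
theorem REPred.of_exists_computable {q : β × ℕ → Bool} (hq : Computable q) :
    REPred fun b => ∃ n, q (b, n) = true := by
  have hfind : Partrec fun b => Nat.rfind fun n => (Part.some (q (b, n)) : Part Bool) :=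
    Partrec.rfind hq.partrec
  refine (Partrec.dom_re hfind).of_eq fun b => ?_
  rw [Part.dom_iff_mem]
  constructor
  · rintro ⟨n, hn⟩
    exact ⟨n, by simpa using Nat.rfind_spec hn⟩
  · rintro ⟨n, hn⟩
    exact Part.dom_iff_mem.1 (Nat.rfind_dom.2 ⟨n, by simpa using hn, fun _ => trivial⟩)

theorem REPred.exists_nat {p : β × ℕ → Prop} (hp : REPred p) : REPred fun b => ∃ n, p (b, n) := by
  obtain ⟨q, hq, h⟩ := hp.exists_computable
  have hc : Computable fun x : β × ℕ => q ((x.1, x.2.unpair.1), x.2.unpair.2) :=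
    hq.comp ((Computable.fst.pair (Computable.fst.comp (Computable.unpair.comp Computable.snd))).pair
      (Computable.snd.comp (Computable.unpair.comp Computable.snd)))
  refine (REPred.of_exists_computable hc).of_eq fun b => ?_
  simp only [h]
  constructor
  · rintro ⟨n, hn⟩
    exact ⟨_, _, hn⟩
  · rintro ⟨n, m, hn⟩
    exact ⟨Nat.pair n m, by simpa using hn⟩

/-- Recursively enumerable predicates are closed under bounded universal quantification: the
semi-decision procedures are run one after the other. -/
theorem REPred.forall_le {p : β × ℕ → Prop} (hp : REPred p) {n : β → ℕ} (hn : Computable n) :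
    REPred fun b => ∀ i ≤ n b, p (b, i) := by
  have hstep : Partrec₂ fun (b : β) (x : ℕ × Unit) =>
      Part.assert (p (b, x.1)) fun _ => Part.some () :=
    Partrec.comp hp
      (Computable.fst.pair (Computable.fst.comp Computable.snd) :
        Computable fun y : β × ℕ × Unit => (y.1, y.2.1))
  have hrec := Partrec.nat_rec (Computable.succ.comp hn)
    (g := fun _ : β => Part.some ()) (Computable.const ()).partrec hstep
  refine (Partrec.dom_re hrec).of_eq fun b => ?_
  have key : ∀ m : ℕ, (Nat.rec (Part.some ()) (fun y IH => IH.bind fun i : Unit =>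
      Part.assert (p (b, y)) fun _ => Part.some ()) m : Part Unit).Dom ↔ ∀ i < m, p (b, i) := by
    intro m
    induction m with
    | zero => simp
    | succ m ih =>
      simp only [Part.bind_dom, ih, Nat.lt_succ_iff_lt_or_eq, or_imp, forall_and, forall_eq]
      simp [Part.assert]
  exact (key _).trans (forall_congr' fun _ => imp_congr_left Nat.lt_succ_iff)

end RecursivelyEnumerable

namespace ComputableMetric

/-! ### Computable rational and real functions -/

section ComputableReal

variable {β γ : Type*} [Primcodable β] [Primcodable γ]

theorem computable_two_pow : Computable fun n : ℕ => 2 ^ n := by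
  refine (Computable.nat_rec Computable.id (Computable.const 1)
    (h := fun (_ : ℕ) (x : ℕ × ℕ) => 2 * x.2) ?_).of_eq fun n => ?_
  · exact (Primrec.nat_mul.comp (Primrec.const 2) (Primrec.snd.comp Primrec.snd)).to_comp
  · induction n with
    | zero => rfl
    | succ n ih => simp only [id] at ih ⊢; rw [ih, pow_succ, mul_comm]

/-- Computable rational functions in a form in which the sign is not separated: the numerator is
a difference of two recursive functions. -/
theorem isComputableRatFun_iff {F : β → ℚ} : IsComputableRatFun F ↔
    ∃ p n b : β → ℕ, Computable p ∧ Computable n ∧ Computable b ∧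
      ∀ x, F x = ((p x : ℚ) - n x) / ((b x : ℚ) + 1) := by
  constructor
  · rintro ⟨a, b, c, ha, hb, hc, h⟩
    have hodd : Computable fun x => (c x).bodd := Computable.nat_bodd.comp hc
    refine ⟨fun x => bif (c x).bodd then 0 else a x, fun x => bif (c x).bodd then a x else 0, b,
      Computable.cond hodd (Computable.const 0) ha,
      Computable.cond hodd ha (Computable.const 0), hb, fun x => ?_⟩
    rw [h]
    rcases hx : (c x).bodd with _ | _
    · have : Even (c x) := by rw [Nat.even_iff, Nat.mod_two_of_bodd, hx]; rfl
      simp [this.neg_one_pow, hx]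
    · have : Odd (c x) := by rw [Nat.odd_iff, Nat.mod_two_of_bodd, hx]; rfl
      simp [this.neg_one_pow, hx, neg_div]
  · rintro ⟨p, n, b, hp, hn, hb, h⟩
    refine ⟨fun x => (p x - n x) + (n x - p x), b, fun x => 1 - (1 - (n x - p x)), ?_, hb, ?_,
      fun x => ?_⟩
    · exact Primrec.nat_add.to_comp.comp (Primrec.nat_sub.to_comp.comp hp hn)
        (Primrec.nat_sub.to_comp.comp hn hp)
    · exact Primrec.nat_sub.to_comp.comp (Computable.const 1) (Primrec.nat_sub.to_comp.comp
        (Computable.const 1) (Primrec.nat_sub.to_comp.comp hn hp))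
    · rw [h]
      rcases le_or_gt (n x) (p x) with hx | hx
      · simp [Nat.sub_eq_zero_of_le hx, Nat.cast_sub hx]
      · have h1 : 1 - (n x - p x) = 0 := by omega
        simp only [h1, Nat.sub_eq_zero_of_le hx.le, Nat.cast_sub hx.le, zero_add]
        ring

theorem IsComputableRatFun.comp {F : γ → ℚ} (hF : IsComputableRatFun F) {f : β → γ}
    (hf : Computable f) : IsComputableRatFun fun x => F (f x) := by
  obtain ⟨a, b, c, ha, hb, hc, h⟩ := hF
  exact ⟨_, _, _, ha.comp hf, hb.comp hf, hc.comp hf, fun x => h (f x)⟩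

theorem IsComputableRatFun.add {F G : β → ℚ} (hF : IsComputableRatFun F)
    (hG : IsComputableRatFun G) : IsComputableRatFun fun x => F x + G x := by
  rw [isComputableRatFun_iff] at hF hG ⊢
  obtain ⟨p, n, b, hp, hn, hb, h⟩ := hF
  obtain ⟨p', n', b', hp', hn', hb', h'⟩ := hG
  have cross : ∀ {u v c d : β → ℕ}, Computable u → Computable v → Computable c → Computable d →
      Computable fun x => u x * (d x + 1) + v x * (c x + 1) := fun hu hv hc hd =>
    Primrec.nat_add.to_comp.comp
      (Primrec.nat_mul.to_comp.comp hu (Computable.succ.comp hd))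
      (Primrec.nat_mul.to_comp.comp hv (Computable.succ.comp hc))
  refine ⟨fun x => p x * (b' x + 1) + p' x * (b x + 1),
    fun x => n x * (b' x + 1) + n' x * (b x + 1),
    fun x => b x * b' x + (b x + b' x), cross hp hp' hb hb', cross hn hn' hb hb',
    Primrec.nat_add.to_comp.comp (Primrec.nat_mul.to_comp.comp hb hb')
      (Primrec.nat_add.to_comp.comp hb hb'), fun x => ?_⟩
  have h1 : (b x : ℚ) + 1 ≠ 0 := by positivity
  have h2 : (b' x : ℚ) + 1 ≠ 0 := by positivity
  have h3 : (b x : ℚ) * b' x + (b x + b' x) + 1 = (b x + 1) * (b' x + 1) := by ring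
  rw [h, h']
  push_cast
  rw [h3]
  field_simp
  ring

theorem IsComputableRatFun.neg {F : β → ℚ} (hF : IsComputableRatFun F) :
    IsComputableRatFun fun x => -F x := by
  rw [isComputableRatFun_iff] at hF ⊢
  obtain ⟨p, n, b, hp, hn, hb, h⟩ := hF
  exact ⟨n, p, b, hn, hp, hb, fun x => by rw [h]; ring⟩

theorem IsComputableRatFun.half_pow : IsComputableRatFun fun n : ℕ => (1 / 2 : ℚ) ^ n := by
  refine ⟨fun _ => 1, fun n => 2 ^ n - 1, fun _ => 0, Computable.const 1,
    Primrec.nat_sub.to_comp.comp computable_two_pow (Computable.const 1), Computable.const 0,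
    fun n => ?_⟩
  simp [Nat.cast_sub (Nat.one_le_two_pow (n := n))]

theorem IsComputableRatFun.pos_re {F : β → ℚ} (hF : IsComputableRatFun F) :
    REPred fun x => 0 < F x := by
  rw [isComputableRatFun_iff] at hF
  obtain ⟨p, n, b, hp, hn, -, h⟩ := hF
  have : REPred fun x => n x < p x :=
    REPred.comp_computable (Primrec.nat_lt.computablePred.to_re) (hn.pair hp)
  refine this.of_eq fun x => ?_
  rw [h, div_pos_iff_of_pos_right (by positivity), sub_pos, Nat.cast_lt]

theorem IsComputableRealFun.comp {f : γ → ℝ} (hf : IsComputableRealFun f) {g : β → γ}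
    (hg : Computable g) : IsComputableRealFun fun x => f (g x) := by
  obtain ⟨F, hF, h⟩ := hf
  exact ⟨fun x => F (g x.1, x.2),
    hF.comp ((hg.comp Computable.fst).pair Computable.snd), fun x i => h (g x) i⟩

theorem IsComputableRatFun.isComputableRealFun {F : β → ℚ} (hF : IsComputableRatFun F) :
    IsComputableRealFun fun x => (F x : ℝ) :=
  ⟨fun x => F x.1, hF.comp Computable.fst, fun x i => by simp⟩

theorem IsComputableRealFun.add {f g : β → ℝ} (hf : IsComputableRealFun f)
    (hg : IsComputableRealFun g) : IsComputableRealFun fun x => f x + g x := by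
  obtain ⟨F, hF, h⟩ := hf
  obtain ⟨G, hG, h'⟩ := hg
  have hs : Computable fun x : β × ℕ => (x.1, x.2 + 1) :=
    Computable.fst.pair (Computable.succ.comp Computable.snd)
  refine ⟨fun x => F (x.1, x.2 + 1) + G (x.1, x.2 + 1), (hF.comp hs).add (hG.comp hs),
    fun x i => ?_⟩
  have h1 := abs_lt.1 (h x (i + 1))
  have h2 := abs_lt.1 (h' x (i + 1))
  rw [pow_succ] at h1 h2
  push_cast
  rw [abs_lt]
  constructor <;> linarith [h1.1, h1.2, h2.1, h2.2]

theorem IsComputableRealFun.neg {f : β → ℝ} (hf : IsComputableRealFun f) :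
    IsComputableRealFun fun x => -f x := by
  obtain ⟨F, hF, h⟩ := hf
  refine ⟨fun x => -F x, hF.neg, fun x i => ?_⟩
  rw [← abs_neg]
  convert h x i using 2
  push_cast
  ring

/-- A strict inequality between computable real functions is semi-decidable. -/
theorem IsComputableRealFun.lt_re {f g : β → ℝ} (hf : IsComputableRealFun f)
    (hg : IsComputableRealFun g) : REPred fun x => f x < g x := by
  obtain ⟨F, hF, h⟩ := hg.add hf.neg
  have hpos : REPred fun x : β × ℕ => 0 < F x + -(1 / 2 : ℚ) ^ x.2 :=
    (hF.add (IsComputableRatFun.half_pow.comp Computable.snd).neg).pos_re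
  refine hpos.exists_nat.of_eq fun x => ?_
  have hcast : ∀ n, 0 < F (x, n) + -(1 / 2 : ℚ) ^ n ↔ (1 / 2 : ℝ) ^ n < (F (x, n) : ℝ) := by
    intro n
    rw [← sub_eq_add_neg, sub_pos, ← Rat.cast_lt (K := ℝ)]
    push_cast
    rfl
  simp only [hcast]
  constructor
  · rintro ⟨n, hn⟩
    have := abs_lt.1 (h x n)
    linarith [this.1]
  · intro hx
    obtain ⟨n, hn⟩ := exists_pow_lt_of_lt_one (show 0 < (g x + -f x) / 2 by linarith)
      (show (1 / 2 : ℝ) < 1 by norm_num)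
    have := abs_lt.1 (h x n)
    exact ⟨n, by linarith [this.2]⟩

/-- The distances from a computable point to the points of the dense sequence are computable. -/
theorem IsComputablePoint.isComputableRealFun_dist {X : Type*} [MetricSpace X] {α : ℕ → X}
    (hα : IsComputableMetricSpace α) {e : X} (he : IsComputablePoint α e) :
    IsComputableRealFun fun n => dist e (α n) := by
  obtain ⟨f, hf, hfe⟩ := he
  obtain ⟨F, hF, h⟩ := hα.computable_dist
  have hs : Computable fun x : ℕ × ℕ => x.2 + 1 := Computable.succ.comp Computable.snd
  refine ⟨fun x => F ((f (x.2 + 1), x.1), x.2 + 1),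
    hF.comp (((hf.comp hs).pair Computable.fst).pair hs), fun n i => ?_⟩
  have h1 := abs_lt.1 (h (f (i + 1), n) (i + 1))
  have h2 := hfe (i + 1)
  have h3 := abs_le.1 (abs_dist_sub_le e (α (f (i + 1))) (α n))
  rw [pow_succ] at h1 h2
  rw [abs_lt]
  constructor <;> linarith [h1.1, h1.2, h3.1, h3.2]

end ComputableReal

/-! ### Certificates that a ray meets a ball -/

section Certificates

variable {X : Type*} [MetricSpace X] (E : EffectiveEnumeration) (α : ℕ → X)

/-- The ball `I i` is formally contained in the ball `I k`: an inequality between the distance of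
their centers and their radii holds that forces even the closed ball of `i` to lie in `I k`. In
contrast to the inclusion itself, it is semi-decidable. -/
def FormallySubset (i k : ℕ) : Prop :=
  dist (α (E.τ₁ i)) (α (E.τ₁ k)) + (E.q (E.τ₂ i) : ℝ) < E.q (E.τ₂ k)

/-- The balls `I i` and `I k` are formally disjoint: the distance of their centers exceeds the sum
of their radii. -/
def FormallyDisjoint (i k : ℕ) : Prop :=
  (E.q (E.τ₂ i) : ℝ) + E.q (E.τ₂ k) < dist (α (E.τ₁ i)) (α (E.τ₁ k))

/-- A finite certificate for `R ∩ I t ≠ ∅`, where `R ⊆ S` is a ray that starts at `e`: the part of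
`S` in a closed ball `b` is covered by `J j`, each ball of which belongs to `J a`, belongs to `J d`,
or is formally contained in `I t`. Here `J a` contains `e`, lies within the ball `b`, and is
formally disjoint from `J d`. So a connected set that leads from `e` out of `b` has to pass from
`J a` to `J d` or out of `b` through `I t`. -/
def IsHitCertificate (S : Set X) (e : X) (t b j a d : ℕ) : Prop :=
  E.closedBall α b ∩ S ⊆ E.openSet α j ∧
  (∃ k ∈ E.index a, e ∈ E.ball α k) ∧
  (∀ k ∈ E.index a, FormallySubset E α k b) ∧
  (∀ k ∈ E.index a, ∀ l ∈ E.index d, FormallyDisjoint E α k l) ∧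
  ∀ k ∈ E.index j, (k ∈ E.index a ∨ k ∈ E.index d) ∨ FormallySubset E α k t

variable {E α}

theorem FormallySubset.ball_subset_ball {i k : ℕ} (h : FormallySubset E α i k) :
    E.ball α i ⊆ E.ball α k :=
  Metric.ball_subset_ball' (by rw [add_comm]; exact h.le)

theorem FormallySubset.ball_subset_closedBall {i k : ℕ} (h : FormallySubset E α i k) :
    E.ball α i ⊆ E.closedBall α k :=
  h.ball_subset_ball.trans Metric.ball_subset_closedBall

theorem FormallyDisjoint.disjoint {i k : ℕ} (h : FormallyDisjoint E α i k) :
    Disjoint (E.ball α i) (E.ball α k) :=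
  Metric.ball_disjoint_ball h.le

end Certificates

/-! ### Semi-decidability of the certificate relation -/

section Semidecidability

namespace EffectiveEnumeration

variable (E : EffectiveEnumeration) {β : Type*} [Primcodable β]

theorem re_forall_mem_index {p : β × ℕ → Prop} (hp : REPred p) {j : β → ℕ} (hj : Computable j) :
    REPred fun x => ∀ k ∈ E.index (j x), p (x, k) := by
  have hs : Computable fun y : β × ℕ => (y.1, E.σ (j y.1) y.2) :=
    Computable.fst.pair (E.computable_σ.comp (hj.comp Computable.fst) Computable.snd)
  refine ((hp.comp_computable hs).forall_le (E.computable_η.comp hj)).of_eq fun x => ?_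
  simp [index]

theorem re_exists_mem_index {p : β × ℕ → Prop} (hp : REPred p) {j : β → ℕ} (hj : Computable j) :
    REPred fun x => ∃ k ∈ E.index (j x), p (x, k) := by
  have hs : Computable fun y : β × ℕ => (y.1, E.σ (j y.1) y.2) :=
    Computable.fst.pair (E.computable_σ.comp (hj.comp Computable.fst) Computable.snd)
  have hle : REPred fun y : β × ℕ => y.2 ≤ E.η (j y.1) :=
    Primrec.nat_le.computablePred.to_re.comp_computable
      (Computable.snd.pair (E.computable_η.comp (hj.comp Computable.fst)))
  refine (hle.and (hp.comp_computable hs)).exists_nat.of_eq fun x => ?_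
  simp only [index, Set.mem_ofPred_eq]
  constructor
  · rintro ⟨u, hu, h⟩
    exact ⟨_, ⟨u, hu, rfl⟩, h⟩
  · rintro ⟨_, ⟨u, hu, rfl⟩, h⟩
    exact ⟨u, hu, h⟩

theorem re_mem_index {k j : β → ℕ} (hk : Computable k) (hj : Computable j) :
    REPred fun x => k x ∈ E.index (j x) := by
  have heq : REPred fun y : β × ℕ => y.2 = k y.1 :=
    (PrimrecRel.comp Primrec.eq Primrec.fst Primrec.snd).computablePred.to_re.comp_computable
      (Computable.snd.pair (hk.comp Computable.fst))
  refine (E.re_exists_mem_index heq hj).of_eq fun x => ?_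
  simp

end EffectiveEnumeration

variable {X : Type*} [MetricSpace X] {E : EffectiveEnumeration} {α : ℕ → X}
  {β : Type*} [Primcodable β] {i k : β → ℕ}

theorem isComputableRealFun_radius (E : EffectiveEnumeration) (hi : Computable i) :
    IsComputableRealFun fun x => (E.q (E.τ₂ (i x)) : ℝ) :=
  E.computable_q.isComputableRealFun.comp (E.computable_τ₂.comp hi)

theorem isComputableRealFun_dist_centers (hα : IsComputableMetricSpace α)
    (E : EffectiveEnumeration) (hi : Computable i) (hk : Computable k) :
    IsComputableRealFun fun x => dist (α (E.τ₁ (i x))) (α (E.τ₁ (k x))) :=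
  hα.computable_dist.comp ((E.computable_τ₁.comp hi).pair (E.computable_τ₁.comp hk))

theorem re_formallySubset (hα : IsComputableMetricSpace α) (hi : Computable i)
    (hk : Computable k) : REPred fun x => FormallySubset E α (i x) (k x) :=
  ((isComputableRealFun_dist_centers hα E hi hk).add (isComputableRealFun_radius E hi)).lt_re
    (isComputableRealFun_radius E hk)

theorem re_formallyDisjoint (hα : IsComputableMetricSpace α) (hi : Computable i)
    (hk : Computable k) : REPred fun x => FormallyDisjoint E α (i x) (k x) :=
  ((isComputableRealFun_radius E hi).add (isComputableRealFun_radius E hk)).lt_re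
    (isComputableRealFun_dist_centers hα E hi hk)

theorem IsComputablePoint.re_mem_ball (hα : IsComputableMetricSpace α) {e : X}
    (he : IsComputablePoint α e) (hi : Computable i) :
    REPred fun x => e ∈ E.ball α (i x) :=
  ((he.isComputableRealFun_dist hα).comp (E.computable_τ₁.comp hi)).lt_re
    (isComputableRealFun_radius E hi)

theorem re_isHitCertificate (hα : IsComputableMetricSpace α) {S : Set X} (hS : IsSemiCCB E α S)
    {e : X} (he : IsComputablePoint α e) {t b j a d : β → ℕ} (ht : Computable t)
    (hb : Computable b) (hj : Computable j) (ha : Computable a) (hd : Computable d) :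
    REPred fun x => IsHitCertificate E α S e (t x) (b x) (j x) (a x) (d x) := by
  have hfst : Computable fun y : β × ℕ => y.1 := Computable.fst
  have hsnd : Computable fun y : β × ℕ => y.2 := Computable.snd
  have hdisj : REPred fun y : β × ℕ => ∀ l ∈ E.index (d y.1), FormallyDisjoint E α y.2 l :=
    E.re_forall_mem_index (p := fun z : (β × ℕ) × ℕ => FormallyDisjoint E α z.1.2 z.2)
      (re_formallyDisjoint hα (hsnd.comp Computable.fst) Computable.snd) (hd.comp hfst)
  have hlabel : REPred fun y : β × ℕ => (y.2 ∈ E.index (a y.1) ∨ y.2 ∈ E.index (d y.1)) ∨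
      FormallySubset E α y.2 (t y.1) :=
    ((E.re_mem_index hsnd (ha.comp hfst)).or (E.re_mem_index hsnd (hd.comp hfst))).or
      (re_formallySubset hα hsnd (ht.comp hfst))
  exact (hS.re_cover.comp_computable (hb.pair hj)).and
    ((E.re_exists_mem_index (he.re_mem_ball hα hsnd) ha).and
    ((E.re_forall_mem_index (re_formallySubset hα hsnd (hb.comp hfst)) ha).and
    ((E.re_forall_mem_index hdisj ha).and (E.re_forall_mem_index hlabel hj))))

theorem re_exists_isHitCertificate (hα : IsComputableMetricSpace α) {S : Set X}
    (hS : IsSemiCCB E α S) {e : X} (he : IsComputablePoint α e) :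
    REPred fun t => ∃ b j a d, IsHitCertificate E α S e t b j a d := by
  -- the parameters `t, b, j, a, d` are packed as `((((t, b), j), a), d)`
  have h : REPred fun x : (((ℕ × ℕ) × ℕ) × ℕ) × ℕ =>
      IsHitCertificate E α S e x.1.1.1.1 x.1.1.1.2 x.1.1.2 x.1.2 x.2 :=
    re_isHitCertificate hα hS he
      (.comp .fst (.comp .fst (.comp .fst .fst))) (.comp .snd (.comp .fst (.comp .fst .fst)))
      (.comp .snd (.comp .fst .fst)) (.comp .snd .fst) .snd
  exact h.exists_nat.exists_nat.exists_nat.exists_nat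

end Semidecidability

/-! ### Soundness of certificates -/

section Soundness

variable {X : Type*} [MetricSpace X] {E : EffectiveEnumeration} {α : ℕ → X}

theorem EffectiveEnumeration.isOpen_openSet (E : EffectiveEnumeration) (α : ℕ → X) (j : ℕ) :
    IsOpen (E.openSet α j) :=
  isOpen_biUnion fun _ _ => Metric.isOpen_ball

/-- Certificates are sound: if `R` missed `I t`, it would be covered by the disjoint open sets `J a`
and `J d ∪ bᶜ`; it meets the first in `e` and the second because it is unbounded. -/
theorem IsHitCertificate.nonempty_inter {S R : Set X} {e : X} {t b j a d : ℕ}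
    (h : IsHitCertificate E α S e t b j a d) (hR : IsPreconnected R) (hRS : R ⊆ S) (heR : e ∈ R)
    (hunb : ¬ Bornology.IsBounded R) : (R ∩ E.ball α t).Nonempty := by
  obtain ⟨hcov, ⟨k₀, hk₀, hek₀⟩, hab, had, hj⟩ := h
  by_contra hne
  have hmiss : ∀ x ∈ R, x ∉ E.ball α t := fun x hx hxt => hne ⟨x, hx, hxt⟩
  have haB : E.openSet α a ⊆ E.closedBall α b :=
    Set.iUnion₂_subset fun k hk => (hab k hk).ball_subset_closedBall
  have hbounded : Bornology.IsBounded (E.closedBall α b) := Metric.isBounded_closedBall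
  obtain ⟨y, hyR, hyB⟩ : ∃ y ∈ R, y ∉ E.closedBall α b :=
    Set.not_subset.1 fun hsub => hunb (hbounded.subset hsub)
  have hsplit : R ⊆ E.openSet α a ∪ (E.openSet α d ∪ (E.closedBall α b)ᶜ) := by
    intro x hx
    by_cases hxB : x ∈ E.closedBall α b
    · obtain ⟨k, hk, hxk⟩ := Set.mem_iUnion₂.1 (hcov ⟨hxB, hRS hx⟩)
      rcases hj k hk with (hka | hkd) | hkt
      · exact Or.inl (Set.mem_iUnion₂.2 ⟨k, hka, hxk⟩)
      · exact Or.inr (Or.inl (Set.mem_iUnion₂.2 ⟨k, hkd, hxk⟩))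
      · exact absurd (hkt.ball_subset_ball hxk) (hmiss x hx)
    · exact Or.inr (Or.inr hxB)
  obtain ⟨x, -, hxa, hxd | hxB⟩ := hR _ _ (E.isOpen_openSet α a)
    ((E.isOpen_openSet α d).union Metric.isClosed_closedBall.isOpen_compl) hsplit
    ⟨e, heR, Set.mem_iUnion₂.2 ⟨k₀, hk₀, hek₀⟩⟩ ⟨y, hyR, Or.inr hyB⟩
  · obtain ⟨k, hk, hxk⟩ := Set.mem_iUnion₂.1 hxa
    obtain ⟨l, hl, hxl⟩ := Set.mem_iUnion₂.1 hxd
    exact Set.disjoint_left.1 (had k hk l hl).disjoint hxk hxl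
  · exact hxB (haB hxa)

end Soundness

/-! ### Existence of certificates -/

section Completeness

variable {X : Type*} [MetricSpace X] {E : EffectiveEnumeration} {α : ℕ → X}

theorem EffectiveEnumeration.finite_index (E : EffectiveEnumeration) (j : ℕ) :
    (E.index j).Finite :=
  (Set.finite_Iic (E.η j)).image (E.σ j)

theorem EffectiveEnumeration.exists_index_eq (E : EffectiveEnumeration) {s : Set ℕ}
    (hs : s.Finite) (hne : s.Nonempty) : ∃ j, E.index j = s := by
  have hl : hs.toFinset.toList ≠ [] := by simpa using hne.ne_empty
  obtain ⟨j, hj⟩ := E.exists_eq_list _ hl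
  refine ⟨j, Set.ext fun k => ?_⟩
  have : k ∈ (List.range (E.η j + 1)).map (E.σ j) ↔ k ∈ s := by rw [hj]; simp
  rw [← this]
  simp [index]

theorem EffectiveEnumeration.radius_pos (E : EffectiveEnumeration) (i : ℕ) :
    0 < (E.q (E.τ₂ i) : ℝ) := by
  have : E.q (E.τ₂ i) ∈ Set.Ioi (0 : ℚ) := E.range_q ▸ Set.mem_range_self _
  exact_mod_cast this

theorem EffectiveEnumeration.exists_ball (E : EffectiveEnumeration) (n : ℕ) {r : ℚ} (hr : 0 < r) :
    ∃ i, E.τ₁ i = n ∧ E.q (E.τ₂ i) = r := by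
  obtain ⟨m, hm⟩ : r ∈ Set.range E.q := by rw [E.range_q]; exact hr
  obtain ⟨i, hi⟩ := E.surjective_τ (n, m)
  obtain ⟨h1, h2⟩ := Prod.mk.inj hi
  exact ⟨i, h1, by rw [h2, hm]⟩

theorem EffectiveEnumeration.exists_mem_ball (E : EffectiveEnumeration) (hα : DenseRange α) (x : X)
    {ε : ℝ} (hε : 0 < ε) : ∃ i, x ∈ E.ball α i ∧ (E.q (E.τ₂ i) : ℝ) < ε := by
  obtain ⟨r, hr0, hrε⟩ := exists_rat_btwn hε
  obtain ⟨n, hn⟩ := hα.exists_dist_lt x hr0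
  obtain ⟨i, rfl, rfl⟩ := E.exists_ball n (by exact_mod_cast hr0)
  exact ⟨i, hn, hrε⟩

/-- A nonempty compact set is covered by finitely many arbitrarily small rational balls that meet
it. -/
theorem EffectiveEnumeration.exists_cover (E : EffectiveEnumeration) (hα : DenseRange α)
    {K : Set X} (hK : IsCompact K) (hne : K.Nonempty) {ε : ℝ} (hε : 0 < ε) :
    ∃ j, K ⊆ E.openSet α j ∧
      ∀ k ∈ E.index j, (E.q (E.τ₂ k) : ℝ) < ε ∧ ∃ x ∈ K, x ∈ E.ball α k := by
  choose i hi hiε using fun x => E.exists_mem_ball hα x hε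
  obtain ⟨T, hTK, hT⟩ := hK.elim_nhds_subcover (fun x => E.ball α (i x))
    fun x _ => Metric.isOpen_ball.mem_nhds (hi x)
  have hTne : (T : Set X).Nonempty := by
    obtain ⟨x, hx⟩ := hne
    obtain ⟨y, hy, -⟩ := Set.mem_iUnion₂.1 (hT hx)
    exact ⟨y, hy⟩
  obtain ⟨j, hj⟩ := E.exists_index_eq (T.finite_toSet.image i) (hTne.image i)
  refine ⟨j, ?_, ?_⟩
  · intro x hx
    obtain ⟨y, hy, hxy⟩ := Set.mem_iUnion₂.1 (hT hx)
    exact Set.mem_iUnion₂.2 ⟨i y, hj ▸ Set.mem_image_of_mem i hy, hxy⟩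
  · rw [hj]
    rintro _ ⟨y, hy, rfl⟩
    exact ⟨hiε y, y, hTK y hy, hi y⟩

/-- A certificate exists whenever `S` splits, up to a compact piece `M` inside `I t`, into a compact
part `A` that contains `e` and a closed part `C` that is disjoint from `A`. -/
theorem IsSemiCCB.exists_isHitCertificate {S : Set X} (hS : IsSemiCCB E α S) (hα : DenseRange α)
    {t : ℕ} {e : X} {A M C : Set X} (hA : IsCompact A) (hM : IsCompact M) (hC : IsClosed C)
    (hCne : C.Nonempty) (heA : e ∈ A) (hMne : M.Nonempty) (hMt : M ⊆ E.ball α t)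
    (hAC : Disjoint A C) (hSeq : S = A ∪ M ∪ C) :
    ∃ b j a d, IsHitCertificate E α S e t b j a d := by
  obtain ⟨ρ, hρ, hthick⟩ := hAC.exists_thickenings hA hC
  have hsep : ∀ x ∈ A, ∀ y ∈ C, ρ ≤ dist x y := by
    intro x hx y hy
    by_contra! hlt
    exact Set.disjoint_left.1 hthick (Metric.self_subset_thickening hρ A hx)
      (Metric.mem_thickening_iff.2 ⟨y, hy, hlt⟩)
  -- by compactness, `M` stays away from the boundary of `I t`
  obtain ⟨z, hzM, hz⟩ := hM.exists_isMaxOn hMne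
    (continuous_id.dist continuous_const : Continuous fun x => dist x (α (E.τ₁ t))).continuousOn
  have hzt : dist z (α (E.τ₁ t)) < E.q (E.τ₂ t) := hMt hzM
  obtain ⟨y₀, hy₀⟩ := hCne
  -- the ball `b` contains `A` with margin `2`, and also the point `y₀` of `C`
  obtain ⟨N, hN⟩ := hA.isBounded.subset_closedBall (α 0)
  obtain ⟨Q, hQ⟩ := exists_rat_gt (max (max (N + 2) (dist y₀ (α 0))) 0)
  obtain ⟨⟨hQN, hQy⟩, hQ0⟩ : ((N + 2 < Q) ∧ dist y₀ (α 0) < Q) ∧ (0 : ℝ) < Q := by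
    simpa only [max_lt_iff] using hQ
  obtain ⟨b, hb0, hbQ⟩ := E.exists_ball 0 (r := Q) (by exact_mod_cast hQ0)
  have hB : E.closedBall α b = Metric.closedBall (α 0) Q := by
    rw [EffectiveEnumeration.closedBall, hb0, hbQ]
  obtain ⟨ε, hε, hε1, hερ, hεt⟩ : ∃ ε : ℝ, 0 < ε ∧ ε ≤ 1 ∧ ε ≤ ρ / 4 ∧
      ε ≤ ((E.q (E.τ₂ t) : ℝ) - dist z (α (E.τ₁ t))) / 2 :=
    ⟨min 1 (min (ρ / 4) (((E.q (E.τ₂ t) : ℝ) - dist z (α (E.τ₁ t))) / 2)),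
      lt_min one_pos (lt_min (by linarith) (by linarith)), min_le_left _ _,
      (min_le_right _ _).trans (min_le_left _ _), (min_le_right _ _).trans (min_le_right _ _)⟩
  have hD : IsCompact (C ∩ E.closedBall α b) := by
    have h : C ∩ E.closedBall α b = (S ∩ E.closedBall α b) ∩ C := by
      rw [hSeq]
      ext x
      simp only [Set.mem_inter_iff, Set.mem_union]
      tauto
    rw [h]
    exact (hS.isCompact _ _ (E.radius_pos b)).inter_right hC
  have hDne : (C ∩ E.closedBall α b).Nonempty := ⟨y₀, hy₀, by rw [hB]; exact hQy.le⟩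
  obtain ⟨a, haA, ha⟩ := E.exists_cover hα hA ⟨e, heA⟩ hε
  obtain ⟨m, hmM, hm⟩ := E.exists_cover hα hM hMne hε
  obtain ⟨d, hdD, hd⟩ := E.exists_cover hα hD hDne hε
  obtain ⟨k₀, hk₀, hek₀⟩ := Set.mem_iUnion₂.1 (haA heA)
  obtain ⟨j, hj⟩ := E.exists_index_eq
    (((E.finite_index a).union (E.finite_index d)).union (E.finite_index m))
    ⟨k₀, Or.inl (Or.inl hk₀)⟩
  refine ⟨b, j, a, d, ?_, ⟨k₀, hk₀, hek₀⟩, ?_, ?_, ?_⟩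
  · have hcover : ∀ {i}, E.index i ⊆ E.index j → E.openSet α i ⊆ E.openSet α j :=
      fun h => Set.biUnion_subset_biUnion_left h
    rintro x ⟨hxB, hxS⟩
    rw [hSeq] at hxS
    rcases hxS with (hx | hx) | hx
    · exact hcover (hj ▸ fun k hk => Or.inl (Or.inl hk)) (haA hx)
    · exact hcover (hj ▸ fun k hk => Or.inr hk) (hmM hx)
    · exact hcover (hj ▸ fun k hk => Or.inl (Or.inr hk)) (hdD ⟨hx, hxB⟩)
  · intro k hk
    obtain ⟨hkε, x, hx, hxk⟩ := ha k hk
    have h1 : dist x (α (E.τ₁ k)) < E.q (E.τ₂ k) := hxk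
    have h2 : dist x (α 0) ≤ N := hN hx
    have h3 := dist_triangle_left (α (E.τ₁ k)) (α 0) x
    rw [FormallySubset, hb0, hbQ]
    linarith
  · intro k hk l hl
    obtain ⟨hkε, x, hx, hxk⟩ := ha k hk
    obtain ⟨hlε, y, hy, hyl⟩ := hd l hl
    have h1 : dist x (α (E.τ₁ k)) < E.q (E.τ₂ k) := hxk
    have h2 : dist y (α (E.τ₁ l)) < E.q (E.τ₂ l) := hyl
    have h3 := hsep x hx y hy.1
    have h4 := dist_triangle4 x (α (E.τ₁ k)) (α (E.τ₁ l)) y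
    rw [dist_comm (α (E.τ₁ l)) y] at h4
    rw [FormallyDisjoint]
    linarith
  · intro k hk
    rw [hj] at hk
    refine hk.imp id fun hkm => ?_
    obtain ⟨hkε, x, hx, hxk⟩ := hm k hkm
    have h1 : dist x (α (E.τ₁ k)) < E.q (E.τ₂ k) := hxk
    have h2 : dist x (α (E.τ₁ t)) ≤ dist z (α (E.τ₁ t)) := hz hx
    have h3 := dist_triangle_left (α (E.τ₁ k)) (α (E.τ₁ t)) x
    rw [FormallySubset]
    linarith

end Completeness

/-! ### Topological rays in semi-c.c.b. sets -/

section Ray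

variable {X : Type*} [MetricSpace X] {E : EffectiveEnumeration} {α : ℕ → X}

/-- A parametrization of a closed ray by a function on all of `ℝ`, which is constant on the negative
half-line and restricts to a closed embedding of `[0, ∞)`. -/
theorem IsRayWithEndpoint.exists_parametrization {R : Set X} {e : R} (h : IsRayWithEndpoint R e)
    (hR : IsClosed R) :
    ∃ γ : ℝ → X, Continuous γ ∧ Set.InjOn γ (Set.Ici 0) ∧ γ 0 = e ∧ γ '' Set.Ici 0 = R ∧
      ∀ s, 0 ≤ s → IsClosed (γ '' Set.Ici s) := by
  obtain ⟨f, hf⟩ := h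
  have hγ : ∀ s (hs : s ∈ Set.Ici (0 : ℝ)),
      ((f (Set.projIci 0 s) : R) : X) = f ⟨s, hs⟩ := fun s hs => by
    rw [Set.projIci_of_mem]
  have himage : ∀ s, 0 ≤ s → (fun t => ((f (Set.projIci 0 t) : R) : X)) '' Set.Ici s =
      (fun t : Set.Ici (0 : ℝ) => (f t : X)) '' {t | s ≤ (t : ℝ)} := by
    intro s hs
    ext x
    constructor
    · rintro ⟨t, ht, rfl⟩
      exact ⟨⟨t, hs.trans ht⟩, ht, (hγ t (hs.trans ht)).symm⟩
    · rintro ⟨t, ht, rfl⟩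
      exact ⟨t, ht, hγ t t.2⟩
  refine ⟨fun s => f (Set.projIci 0 s), ?_, ?_, ?_, ?_, ?_⟩
  · exact continuous_subtype_val.comp (f.continuous.comp
      ((continuous_const.max continuous_id).subtype_mk fun _ => le_max_left _ _))
  · intro s hs t ht hst
    simp only [hγ s hs, hγ t ht] at hst
    exact congrArg Subtype.val (f.injective (Subtype.ext hst))
  · simp only [hγ 0 Set.self_mem_Ici, hf]
  · rw [himage 0 le_rfl]
    ext x
    constructor
    · rintro ⟨t, -, rfl⟩
      exact (f t).2
    · intro hx
      exact ⟨f.symm ⟨x, hx⟩, (f.symm ⟨x, hx⟩).2, by simp⟩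
  · intro s hs
    rw [himage s hs]
    exact (hR.isClosedEmbedding_subtypeVal.comp f.isClosedEmbedding).isClosedMap _
      (isClosed_Ici.preimage continuous_subtype_val)

theorem IsRayWithEndpoint.isPreconnected {R : Set X} {e : R} (h : IsRayWithEndpoint R e) :
    IsPreconnected R := by
  obtain ⟨f, -⟩ := h
  have : PreconnectedSpace (Set.Ici (0 : ℝ)) := Subtype.preconnectedSpace isPreconnected_Ici
  exact isPreconnected_iff_preconnectedSpace.2
    (f.surjective.denseRange.preconnectedSpace f.continuous)

theorem IsRayWithEndpoint.not_isCompact {R : Set X} {e : R} (h : IsRayWithEndpoint R e) :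
    ¬ IsCompact R := by
  obtain ⟨f, -⟩ := h
  intro hR
  have : CompactSpace R := isCompact_iff_compactSpace.1 hR
  have hIci : IsCompact (Set.Ici (0 : ℝ)) := isCompact_iff_compactSpace.2 f.symm.compactSpace
  exact not_bddAbove_Ici 0 hIci.bddAbove

theorem IsSemiCCB.isCompact_of_isBounded {S K : Set X} (hS : IsSemiCCB E α S) (hKS : K ⊆ S)
    (hK : IsClosed K) (hb : Bornology.IsBounded K) : IsCompact K := by
  rcases K.eq_empty_or_nonempty with rfl | ⟨x, -⟩
  · exact isCompact_empty
  obtain ⟨r, hr, h⟩ := hb.subset_closedBall_lt 0 x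
  exact (hS.isCompact x r hr).of_isClosed_subset hK (Set.subset_inter hKS h)

theorem IsSemiCCB.isClosed {S : Set X} (hS : IsSemiCCB E α S) : IsClosed S := by
  refine isClosed_of_closure_subset fun x hx => ?_
  have h : x ∈ closure (S ∩ Metric.closedBall x 1) :=
    mem_closure_iff_nhds.2 fun U hU => by
      obtain ⟨y, ⟨hyU, hyB⟩, hyS⟩ := mem_closure_iff_nhds.1 hx _
        (Filter.inter_mem hU (Metric.closedBall_mem_nhds x one_pos))
      exact ⟨y, hyU, hyS, hyB⟩
  exact ((hS.isCompact x 1 one_pos).isClosed.closure_subset h).1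

/-- Certificates are complete for rays: removing from the ray a short arc inside `I t` leaves a
compact initial part, which contains the endpoint, and a closed final part. -/
theorem IsRayWithEndpoint.exists_isHitCertificate {R F : Set X} {e : R}
    (h : IsRayWithEndpoint R e) (hα : DenseRange α) (hR : IsClosed R) (hF : IsClosed F)
    (hRF : Disjoint R F) (hS : IsSemiCCB E α (R ∪ F)) {t : ℕ} (ht : (R ∩ E.ball α t).Nonempty) :
    ∃ b j a d, IsHitCertificate E α (R ∪ F) e t b j a d := by
  obtain ⟨γ, hγ, hinj, hγ0, hγR, hγcl⟩ := h.exists_parametrization hR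
  obtain ⟨x, hxR, hxt⟩ := ht
  rw [← hγR] at hxR
  obtain ⟨s, hs, rfl⟩ := hxR
  have hs : 0 ≤ s := hs
  obtain ⟨δ, hδ, hball⟩ := Metric.isOpen_iff.1 (Metric.isOpen_ball.preimage hγ) s hxt
  -- the ray passes through `I t` on `[u, v]`; as `u < v`, its parts before `u` and after `v` are
  -- disjoint
  obtain ⟨u, v, hu, huv, hmid⟩ :
      ∃ u v, 0 ≤ u ∧ u < v ∧ Set.Icc u v ⊆ γ ⁻¹' E.ball α t := by
    refine ⟨s, s + δ / 2, hs, by linarith, fun y hy => hball ?_⟩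
    rw [Metric.mem_ball, Real.dist_eq, abs_lt]
    constructor <;> linarith [hy.1, hy.2]
  have hIcc : ∀ a b : ℝ, IsCompact (γ '' Set.Icc a b) := fun a b => isCompact_Icc.image hγ
  refine hS.exists_isHitCertificate hα (A := γ '' Set.Icc 0 u) (M := γ '' Set.Icc u v)
    (C := γ '' Set.Ici v ∪ F) (hIcc _ _) (hIcc _ _) ((hγcl v (hu.trans huv.le)).union hF)
    ⟨γ v, Or.inl ⟨v, Set.self_mem_Ici, rfl⟩⟩ ⟨0, ⟨le_rfl, hu⟩, hγ0⟩
    ⟨γ u, u, ⟨le_rfl, huv.le⟩, rfl⟩ (Set.image_subset_iff.2 hmid) ?_ ?_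
  · rw [Set.disjoint_union_right]
    constructor
    · rw [Set.disjoint_left]
      rintro _ ⟨y, hy, rfl⟩ ⟨z, hz, hzy⟩
      have hvz : v ≤ z := hz
      have : z = y := hinj ((hu.trans huv.le).trans hvz) hy.1 hzy
      linarith [hy.2]
    · exact hRF.mono_left (hγR ▸ Set.image_mono Set.Icc_subset_Ici_self)
  · rw [← Set.image_union, ← Set.union_assoc, ← Set.image_union, Set.Icc_union_Icc_eq_Icc hu huv.le,
      Set.Icc_union_Ici_eq_Ici (hu.trans huv.le), hγR]

end Ray

end ComputableMetric

theorem mainTheorem3 {X : Type*} [MetricSpace X] (α : ℕ → X)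
    (hα : ComputableMetric.IsComputableMetricSpace α)
    (E : ComputableMetric.EffectiveEnumeration) :
    (∀ (R F : Set X) (e : R),
      ComputableMetric.IsRayWithEndpoint R e →
      ComputableMetric.IsComputablePoint α (e : X) →
      IsClosed R → IsClosed F → Disjoint R F →
      ComputableMetric.IsSemiCCB E α (R ∪ F) →
      ComputableMetric.IsCE E α R) ∧
    (∀ (R : Set X) (e : R),
      ComputableMetric.IsRayWithEndpoint R e →
      ComputableMetric.IsComputablePoint α (e : X) →
      ComputableMetric.IsSemiCCB E α R →
      ComputableMetric.IsCCB E α R) := by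
  have main : ∀ (R F : Set X) (e : R),
      ComputableMetric.IsRayWithEndpoint R e →
      ComputableMetric.IsComputablePoint α (e : X) →
      IsClosed R → IsClosed F → Disjoint R F →
      ComputableMetric.IsSemiCCB E α (R ∪ F) →
      ComputableMetric.IsCE E α R := by
    intro R F e hray he hR hF hRF hS
    have hunb : ¬ Bornology.IsBounded R := fun hb =>
      hray.not_isCompact (hS.isCompact_of_isBounded Set.subset_union_left hR hb)
    refine ⟨hR, (ComputableMetric.re_exists_isHitCertificate hα hS he).of_eq fun t => ⟨?_, ?_⟩⟩
    · rintro ⟨b, j, a, d, h⟩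
      exact h.nonempty_inter hray.isPreconnected Set.subset_union_left e.2 hunb
    · exact hray.exists_isHitCertificate hα.dense hR hF hRF hS
  refine ⟨main, fun R e hray he hS => ⟨hS, ?_⟩⟩
  exact main R ∅ e hray he hS.isClosed isClosed_empty (Set.disjoint_empty R)
    (by rwa [Set.union_empty])
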